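/- Let $\Phi_a\subset\mathbb{R}^2$ (the access points, APs) be a homogeneous Poisson point process of density $\lambda_a>0$, and let $\lambda_u>0$ (the density of the user equipments, UEs). Let $X^*$ be the (a.s. unique) point of $\Phi_a$ closest to the origin $o$, and let $$\mathcal V^*=\{y\in\mathbb{R}^2:\ |y-X^*|<|y-z|\ \text{ for all } z\in\Phi_a\setminus\{X^*\}\}$$ be its Voronoi cell. For $x,x^*\in\mathbb{R}^2$ let $p_c(x\mid x^*)=\mathbb{P}(x\in\mathcal V^*\mid X^*=x^*)$, understood as $$p_c(x\mid x^*)=\lim_{\varepsilon\downarrow0}\mathbb{P}\big(x\in\mathcal V^*\,\big|\,|X^*-x^*|<\varepsilon\big)$$ (for $x^*=o$ this is conditioning on an AP being located at the origin). For a receiver position $x_R\in\mathbb{R}^2$ define the equivalent UE density, given $X^*=x^*$, by $$\lambda_{x_R,u}(r)=\lambda_u\Big(1-\frac1{2\pi}\int_0^{2\pi}p_c\big((r\cos\theta,r\sin\theta)+x_R\mid x^*\big)\,d\theta\Big),\qquad r\ge0.$$ Then for every $x^*\in\mathbb{R}^2$ the limits defining $p_c(\cdot\mid x^*)$ exist,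 the integrals defining $\lambda_{x^*,u}(r)$, $r\ge 0$, exist, and at the serving AP ($x_R=x^*$) $$\lambda_{x^*,u}(r)=\lambda_u\lambda_a b\pi r^2+O(r^3),\qquad r\to0^+,$$ where $b=1$ if $x^*=o$, and $b=1/2$ if $x^*\neq o$ (whatever the value of $|x^*|>0$); the constant in $O(r^3)$ may depend on $x^*,\lambda_a,\lambda_u$. -/

import Mathlib

open MeasureTheory ProbabilityTheory Filter Topology Asymptotics

noncomputable section

namespace CellularNetwork

/-- The plane `ℝ²` with the Euclidean norm and Lebesgue measure (`volume`). -/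
abbrev Plane : Type := EuclideanSpace ℝ (Fin 2)

/-- The point of the plane with polar coordinates `(r, θ)`. -/
def polar (r θ : ℝ) : Plane := !₂[r * Real.cos θ, r * Real.sin θ]

/-- `Φ` is a homogeneous Poisson point process of density `intensity` on the plane, seen as a random
subset of the plane: it is almost surely locally finite, the number of its points in a bounded Borel
set `B` is a Poisson random variable of mean `intensity * |B|`, and the numbers of points in finitely
many pairwise disjoint bounded Borel sets are independent. -/
structure IsHomogeneousPPP {Ω : Type*} [MeasurableSpace Ω] (P : Measure Ω) (Φ : Ω → Set Plane)
    (intensity : ℝ) : Prop where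
  locallyFinite : ∀ᵐ ω ∂P, ∀ B : Set Plane, Bornology.IsBounded B → (Φ ω ∩ B).Finite
  measurable_count : ∀ B : Set Plane, MeasurableSet B → Bornology.IsBounded B →
    Measurable (fun ω => (Φ ω ∩ B).ncard)
  count_law : ∀ B : Set Plane, MeasurableSet B → Bornology.IsBounded B →
    HasLaw (fun ω => (Φ ω ∩ B).ncard)
      (poissonMeasure (Real.toNNReal (intensity * volume.real B))) P
  count_indep : ∀ (n : ℕ) (B : Fin n → Set Plane), (∀ i, MeasurableSet (B i)) →
    (∀ i, Bornology.IsBounded (B i)) → Pairwise (fun i j => Disjoint (B i) (B j)) →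
    iIndepFun (fun i ω => (Φ ω ∩ B i).ncard) P

/-- The point of `S` closest to the origin. It is used for realizations of a homogeneous Poisson
process of positive density, where almost surely there is exactly one closest point. -/
def nearestPoint (S : Set Plane) : Plane :=
  Classical.epsilon (fun y => y ∈ S ∧ ∀ z ∈ S, ‖y‖ ≤ ‖z‖)

/-- The (open) Voronoi cell of `p` generated by the point set `S`. -/
def voronoiCell (S : Set Plane) (p : Plane) : Set Plane :=
  {y | ∀ z ∈ S \ {p}, dist y p < dist y z}

/-- The elementary conditional probability that `x` lies in the Voronoi cell of the point of `Φ`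
nearest to the origin, given that this nearest point lies within distance `ε` of `xs`. -/
def cellProbNear {Ω : Type*} [MeasurableSpace Ω] (P : Measure Ω) (Φ : Ω → Set Plane)
    (xs x : Plane) (ε : ℝ) : ℝ :=
  P.real {ω | x ∈ voronoiCell (Φ ω) (nearestPoint (Φ ω)) ∧ nearestPoint (Φ ω) ∈ Metric.ball xs ε} /
    P.real {ω | nearestPoint (Φ ω) ∈ Metric.ball xs ε}

/-- The probabilistic cell area function `p_c(x ∣ xs)`: the conditional probability that `x` lies in
the Voronoi cell of the point of `Φ` nearest to the origin, given that this nearest point is `xs`.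
Conditioning on this null event is by shrinking neighbourhoods of `xs`, which singles out a value at
every `xs`; for `xs = 0` it is conditioning on `Φ` having a point at the origin. -/
def pca {Ω : Type*} [MeasurableSpace Ω] (P : Measure Ω) (Φ : Ω → Set Plane)
    (xs x : Plane) : ℝ :=
  limUnder (𝓝[>] (0 : ℝ)) (cellProbNear P Φ xs x)

/-- The equivalent density, at distance `r` from a receiver at `xR`, of the interfering UEs (of
density `lamU`) outside the Voronoi cell of the nearest AP, conditioned on that AP being at `xs`. -/
def ueDensity {Ω : Type*} [MeasurableSpace Ω] (P : Measure Ω) (Φ : Ω → Set Plane)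
    (lamU : ℝ) (xs xR : Plane) (r : ℝ) : ℝ :=
  lamU * (1 - 1 / (2 * Real.pi) * ∫ θ in (0 : ℝ)..(2 * Real.pi), pca P Φ xs (polar r θ + xR))

end CellularNetwork

end

/-! Given that the nearest AP is at `xs`, the disc `B(0, ‖xs‖)` contains no AP, and `x` lies in the
cell exactly when `B(x, |x - xs|)` contains none either. Independence and void probabilities give
`p_c = exp (-λ_a |B(x, |x - xs|) \ B(0, ‖xs‖)|)` (`pca_eq`). The limit `ε → 0` is justified by a
sandwich: moving the AP by less than `ε` changes both radii by less than `ε` (`tendsto_prob_div`).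

For `x = xs + polar r θ`, let `V(θ)` be the area in the exponent. Since `V(θ) ≤ π r²`, one has `1 -
p_c = λ_a V(θ) + O(r⁴)`, so only the mean of `V` matters. If `xs = 0`, then `V = π r²`, so `b = 1`.
Otherwise `V(θ)` ranges from `0` to `π r²` with the direction, but opposite directions compensate.
Reflection through `xs` turns `V(θ + π)` into the area left in the disc of direction `θ` by the disc
`B(2 xs, ‖xs‖)`, tangent to `B(0, ‖xs‖)` at `xs`. Hence `V(θ) + V(θ + π)` is `π r²` plus the part of
the small disc lying outside both tangent discs. That cusp-shaped part fits in a rectangle with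
sides `O(r²)` and `O(r)`, so its area is `O(r³)`, and the mean of `V` is `π r² / 2 + O(r³)`
(`abs_volume_real_ball_diff_add_sub_le`). -/

namespace CellularNetwork

/-! ### Areas of discs and of perturbed unions of discs -/

theorem volume_real_ball (a : Plane) (p : ℝ) :
    volume.real (Metric.ball a p) = Real.pi * (max p 0) ^ 2 := by
  have h : (max p 0) = (ENNReal.ofReal p).toReal := by
    rw [ENNReal.toReal_ofReal']
  rw [measureReal_def, EuclideanSpace.volume_ball_fin_two, h, ENNReal.toReal_mul,
    ENNReal.toReal_pow, ENNReal.toReal_ofReal Real.pi_pos.le, mul_comm]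

theorem volume_real_ball_diff_ball_le (a : Plane) (p q : ℝ) :
    volume.real (Metric.ball a p \ Metric.ball a q) ≤
      |Real.pi * (max p 0) ^ 2 - Real.pi * (max q 0) ^ 2| := by
  rcases le_total p q with h | h
  · rw [Set.sdiff_eq_empty.2 (Metric.ball_subset_ball h), measureReal_empty]
    positivity
  · rw [measureReal_sdiff (Metric.ball_subset_ball h) measurableSet_ball, volume_real_ball,
      volume_real_ball]
    exact le_abs_self _

/-- Perturbing the radii of two balls and removing a small ball barely changes the area of their
union. -/
theorem tendsto_volume_real_ball_union_diff (a b c : Plane) (p q : ℝ) {τ : ℝ → ℝ}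
    (hτ : Tendsto τ (𝓝[>] 0) (𝓝 0)) :
    Tendsto (fun ε => volume.real
        ((Metric.ball a (p + τ ε) ∪ Metric.ball b (q + τ ε)) \ Metric.ball c ε)) (𝓝[>] 0)
      (𝓝 (volume.real (Metric.ball a p ∪ Metric.ball b q))) := by
  -- The truncation at `0` matters: a shrunken radius such as `‖xs‖ - ε` is negative when `xs = 0`.
  have hf : Continuous fun t : ℝ => Real.pi * (max t 0) ^ 2 := by fun_prop
  have key : ∀ t : ℝ, Tendsto (fun ε => |Real.pi * (max (t + τ ε) 0) ^ 2 -
      Real.pi * (max t 0) ^ 2|) (𝓝[>] 0) (𝓝 0) := by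
    intro t
    have h1 : Tendsto (fun ε => t + τ ε) (𝓝[>] 0) (𝓝 t) := by
      simpa using hτ.const_add t
    have h2 : Tendsto (fun ε => |Real.pi * (max (t + τ ε) 0) ^ 2 - Real.pi * (max t 0) ^ 2|)
        (𝓝[>] 0) (𝓝 |Real.pi * (max t 0) ^ 2 - Real.pi * (max t 0) ^ 2|) :=
      (((hf.tendsto t).comp h1).sub_const (Real.pi * (max t 0) ^ 2)).abs
    rwa [sub_self, abs_zero] at h2
  have hε : Tendsto (fun ε : ℝ => Real.pi * (max ε 0) ^ 2) (𝓝[>] 0) (𝓝 0) := by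
    simpa using (hf.tendsto 0).mono_left nhdsWithin_le_nhds
  have herr := ((key p).add (key q)).add hε
  simp only [add_zero] at herr
  rw [tendsto_iff_dist_tendsto_zero]
  refine squeeze_zero (fun _ => dist_nonneg) (fun ε => ?_) herr
  set A := Metric.ball a p
  set A' := Metric.ball a (p + τ ε)
  set B := Metric.ball b q
  set B' := Metric.ball b (q + τ ε)
  set D := Metric.ball c ε
  have fin : ∀ S : Set Plane, Bornology.IsBounded S → volume S ≠ ⊤ := fun S hS =>
    hS.measure_lt_top.ne
  have bA : Bornology.IsBounded A := Metric.isBounded_ball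
  have bA' : Bornology.IsBounded A' := Metric.isBounded_ball
  have bB : Bornology.IsBounded B := Metric.isBounded_ball
  have bB' : Bornology.IsBounded B' := Metric.isBounded_ball
  have bD : Bornology.IsBounded D := Metric.isBounded_ball
  -- The two unions differ by at most the annuli between concentric discs and the removed disc `D`.
  have h1 : volume.real (A ∪ B) ≤ volume.real ((A' ∪ B') \ D) + volume.real (A \ A') +
      volume.real (B \ B') + volume.real D := by
    have : A ∪ B ⊆ (((A' ∪ B') \ D) ∪ (A \ A')) ∪ (B \ B') ∪ D := by
      intro y hy
      simp only [Set.mem_union, Set.mem_sdiff] at hy ⊢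
      tauto
    refine (measureReal_mono this (fin _ ?_)).trans ?_
    · exact ((((bA'.union bB').subset Set.sdiff_subset).union (bA.subset Set.sdiff_subset)).union
        (bB.subset Set.sdiff_subset)).union bD
    · refine (measureReal_union_le _ _).trans (add_le_add_left ?_ _)
      refine (measureReal_union_le _ _).trans (add_le_add_left ?_ _)
      exact measureReal_union_le _ _
  have h2 : volume.real ((A' ∪ B') \ D) ≤ volume.real (A ∪ B) + volume.real (A' \ A) +
      volume.real (B' \ B) := by
    have : (A' ∪ B') \ D ⊆ ((A ∪ B) ∪ (A' \ A)) ∪ (B' \ B) := by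
      intro y hy
      simp only [Set.mem_union, Set.mem_sdiff] at hy ⊢
      tauto
    refine (measureReal_mono this (fin _ ?_)).trans ?_
    · exact ((bA.union bB).union (bA'.subset Set.sdiff_subset)).union (bB'.subset Set.sdiff_subset)
    · refine (measureReal_union_le _ _).trans (add_le_add_left ?_ _)
      exact measureReal_union_le _ _
  have e1 := volume_real_ball_diff_ball_le a p (p + τ ε)
  have e2 := volume_real_ball_diff_ball_le a (p + τ ε) p
  have e3 := volume_real_ball_diff_ball_le b q (q + τ ε)
  have e4 := volume_real_ball_diff_ball_le b (q + τ ε) q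
  have e5 := volume_real_ball c ε
  have e6 : 0 ≤ volume.real D := measureReal_nonneg
  rw [abs_sub_comm] at e1 e3
  rw [Real.dist_eq, abs_le, ← e5]
  constructor <;> linarith

/-! ### Poisson counts and the limit defining `p_c` -/

section Poisson

variable {Ω : Type*} [MeasurableSpace Ω] {P : Measure Ω} {Φ : Ω → Set Plane} {lam : ℝ}

theorem IsHomogeneousPPP.prob_count_eq (hΦ : IsHomogeneousPPP P Φ lam) (hlam : 0 < lam)
    {B : Set Plane} (hB : MeasurableSet B) (hb : Bornology.IsBounded B) (n : ℕ) :
    P.real {ω | (Φ ω ∩ B).ncard = n} =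
      Real.exp (-(lam * volume.real B)) * (lam * volume.real B) ^ n / n.factorial := by
  have h := (hΦ.count_law B hB hb).measure_eq (p := fun k => k = n) (measurableSet_singleton n)
  have h' : {k : ℕ | k = n} = {n} := rfl
  rw [measureReal_def, h, h', ← measureReal_def, poissonMeasure_real_singleton,
    Real.coe_toNNReal _ (by positivity)]

theorem IsHomogeneousPPP.prob_inter (hΦ : IsHomogeneousPPP P Φ lam)
    {B C : Set Plane} (hB : MeasurableSet B) (hb : Bornology.IsBounded B)
    (hC : MeasurableSet C) (hc : Bornology.IsBounded C) (hd : Disjoint B C) (s t : Set ℕ) :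
    P.real {ω | (Φ ω ∩ B).ncard ∈ s ∧ (Φ ω ∩ C).ncard ∈ t} =
      P.real {ω | (Φ ω ∩ B).ncard ∈ s} * P.real {ω | (Φ ω ∩ C).ncard ∈ t} := by
  have h := hΦ.count_indep 2 ![B, C] (by simp [Fin.forall_fin_two, hB, hC])
    (by simp [Fin.forall_fin_two, hb, hc])
    (by
      intro i j hij
      fin_cases i <;> fin_cases j <;> simp_all [hd.symm])
  have h2 := indepFun_iff_measure_inter_preimage_eq_mul.1 (h.indepFun (i := 0) (j := 1) (by simp))
    s t (MeasurableSet.of_discrete) (MeasurableSet.of_discrete)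
  have h3 := congrArg ENNReal.toReal h2
  rw [ENNReal.toReal_mul] at h3
  exact h3

theorem IsHomogeneousPPP.prob_single_empty (hΦ : IsHomogeneousPPP P Φ lam) (hlam : 0 < lam)
    {B C : Set Plane} (hB : MeasurableSet B) (hb : Bornology.IsBounded B)
    (hC : MeasurableSet C) (hc : Bornology.IsBounded C) (hd : Disjoint B C) :
    P.real {ω | (Φ ω ∩ B).ncard = 1 ∧ (Φ ω ∩ C).ncard = 0} =
      lam * volume.real B *
        (Real.exp (-(lam * volume.real B)) * Real.exp (-(lam * volume.real C))) := by
  have h := hΦ.prob_inter hB hb hC hc hd {1} {0}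
  simp only [Set.mem_singleton_iff] at h
  rw [h, hΦ.prob_count_eq hlam hB hb, hΦ.prob_count_eq hlam hC hc]
  simp
  ring

variable [IsProbabilityMeasure P]

/-- Uses `1 - exp (-t) ≤ t`. Bounding "at least one point" directly spares a separate estimate for
two points in a small ball. -/
theorem IsHomogeneousPPP.prob_nonempty_empty_le (hΦ : IsHomogeneousPPP P Φ lam) (hlam : 0 < lam)
    {B C : Set Plane} (hB : MeasurableSet B) (hb : Bornology.IsBounded B)
    (hC : MeasurableSet C) (hc : Bornology.IsBounded C) (hd : Disjoint B C) :
    P.real {ω | (Φ ω ∩ B).ncard ≠ 0 ∧ (Φ ω ∩ C).ncard = 0} ≤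
      lam * volume.real B * Real.exp (-(lam * volume.real C)) := by
  have h := hΦ.prob_inter hB hb hC hc hd {0}ᶜ {0}
  simp only [Set.mem_singleton_iff, Set.mem_compl_iff] at h
  have hcompl : P.real {ω | ¬ (Φ ω ∩ B).ncard = 0} = 1 - Real.exp (-(lam * volume.real B)) := by
    have h0 := hΦ.prob_count_eq hlam hB hb 0
    have := probReal_compl_eq_one_sub (μ := P) (s := {ω | (Φ ω ∩ B).ncard = 0})
      ((hΦ.measurable_count B hB hb) (measurableSet_singleton 0))
    rw [h0] at this
    simpa [Set.compl_ofPred] using this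
  simp only [ne_eq]
  rw [h, hcompl, hΦ.prob_count_eq hlam hC hc]
  have := Real.add_one_le_exp (-(lam * volume.real B))
  simp only [pow_zero, mul_one, Nat.factorial_zero, Nat.cast_one, div_one]
  gcongr
  linarith

/-- The void probabilities of growing discs tend to `0`. This excludes the arbitrary value of
`nearestPoint` on the empty set. -/
theorem IsHomogeneousPPP.ae_nonempty (hΦ : IsHomogeneousPPP P Φ lam) (hlam : 0 < lam) :
    ∀ᵐ ω ∂P, (Φ ω).Nonempty := by
  have hle : ∀ n : ℕ, P.real {ω | ¬ (Φ ω).Nonempty} ≤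
      Real.exp (-(lam * (Real.pi * (n : ℝ) ^ 2))) := by
    intro n
    have h := hΦ.prob_count_eq hlam (B := Metric.ball (0 : Plane) n) measurableSet_ball
      Metric.isBounded_ball 0
    rw [volume_real_ball, max_eq_left (Nat.cast_nonneg n)] at h
    simp only [pow_zero, mul_one, Nat.factorial_zero, Nat.cast_one, div_one] at h
    rw [← h]
    refine measureReal_mono fun ω hω => ?_
    simp only [Set.mem_ofPred_eq, Set.not_nonempty_iff_eq_empty] at hω ⊢
    simp [hω]
  have hlim : Tendsto (fun n : ℕ => Real.exp (-(lam * (Real.pi * (n : ℝ) ^ 2)))) atTop (𝓝 0) := by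
    refine Real.tendsto_exp_neg_atTop_nhds_zero.comp ?_
    refine Tendsto.const_mul_atTop hlam (Tendsto.const_mul_atTop Real.pi_pos ?_)
    exact (tendsto_pow_atTop two_ne_zero).comp tendsto_natCast_atTop_atTop
  have h0 : P.real {ω | ¬ (Φ ω).Nonempty} = 0 :=
    le_antisymm (ge_of_tendsto' hlim hle) measureReal_nonneg
  rw [ae_iff]
  exact (measureReal_eq_zero_iff).1 h0

theorem nearestPoint_spec {S : Set Plane} (hne : S.Nonempty)
    (hfin : ∀ B : Set Plane, Bornology.IsBounded B → (S ∩ B).Finite) :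
    nearestPoint S ∈ S ∧ ∀ z ∈ S, ‖nearestPoint S‖ ≤ ‖z‖ := by
  obtain ⟨w, hw⟩ := hne
  obtain ⟨y, hy, hmin⟩ := Set.exists_min_image (S ∩ Metric.closedBall 0 ‖w‖) (fun z => ‖z‖)
    (hfin _ Metric.isBounded_closedBall) ⟨w, hw, by simp⟩
  refine Classical.epsilon_spec (p := fun y => y ∈ S ∧ ∀ z ∈ S, ‖y‖ ≤ ‖z‖) ⟨y, hy.1, fun z hz => ?_⟩
  by_cases h : ‖z‖ ≤ ‖w‖
  · exact hmin z ⟨hz, by simpa using h⟩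
  · exact (hmin w ⟨hw, by simp⟩).trans (not_le.1 h).le

/-- Strictness forces the choice. It is needed only for the lower half of the sandwich; the upper
half works with any minimiser, so almost sure uniqueness is never invoked. -/
theorem nearestPoint_eq {S : Set Plane} {p : Plane} (hp : p ∈ S)
    (hlt : ∀ z ∈ S, z ≠ p → ‖p‖ < ‖z‖) : nearestPoint S = p := by
  have h := Classical.epsilon_spec (p := fun y => y ∈ S ∧ ∀ z ∈ S, ‖y‖ ≤ ‖z‖)
    ⟨p, hp, fun z hz => by
      by_cases hzp : z = p
      · rw [hzp]
      · exact (hlt z hz hzp).le⟩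
  by_contra hne
  exact (hlt _ h.1 hne).not_ge (h.2 p hp)

/-- If an event is squeezed between "exactly one point in `ball c ε` and none in `Up ε`" and "some
point in `ball c ε` and none in `Lo ε`", its probability is asymptotic to
`lam * |ball c ε| * exp (-lam * v)`, where `v` is the limit of the areas of `Up ε` and `Lo ε`. -/
theorem IsHomogeneousPPP.tendsto_prob_div (hΦ : IsHomogeneousPPP P Φ lam) (hlam : 0 < lam)
    (c : Plane) (G : ℝ → Set Ω) (Up Lo : ℝ → Set Plane) {v : ℝ}
    (mU : ∀ ε, MeasurableSet (Up ε)) (bU : ∀ ε, Bornology.IsBounded (Up ε))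
    (mL : ∀ ε, MeasurableSet (Lo ε)) (bL : ∀ ε, Bornology.IsBounded (Lo ε))
    (hU : Tendsto (fun ε => volume.real (Up ε \ Metric.ball c ε)) (𝓝[>] 0) (𝓝 v))
    (hL : Tendsto (fun ε => volume.real (Lo ε \ Metric.ball c ε)) (𝓝[>] 0) (𝓝 v))
    (lower : ∀ ε > 0, ∀ᵐ ω ∂P, (Φ ω ∩ Metric.ball c ε).ncard = 1 →
      (Φ ω ∩ (Up ε \ Metric.ball c ε)).ncard = 0 → ω ∈ G ε)
    (upper : ∀ ε > 0, ∀ᵐ ω ∂P, ω ∈ G ε → (Φ ω ∩ Metric.ball c ε).ncard ≠ 0 ∧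
      (Φ ω ∩ (Lo ε \ Metric.ball c ε)).ncard = 0) :
    Tendsto (fun ε => P.real (G ε) / (lam * volume.real (Metric.ball c ε))) (𝓝[>] 0)
      (𝓝 (Real.exp (-(lam * v)))) := by
  have hball : Tendsto (fun ε : ℝ => volume.real (Metric.ball c ε)) (𝓝[>] 0) (𝓝 0) := by
    simp only [volume_real_ball]
    have hf : Continuous fun t : ℝ => Real.pi * (max t 0) ^ 2 := by fun_prop
    simpa using (hf.tendsto 0).mono_left nhdsWithin_le_nhds
  have hpos : ∀ ε : ℝ, 0 < ε → 0 < lam * volume.real (Metric.ball c ε) := by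
    intro ε hε
    rw [volume_real_ball, max_eq_left hε.le]
    positivity
  have lo : Tendsto (fun ε => Real.exp (-(lam * volume.real (Metric.ball c ε))) *
      Real.exp (-(lam * volume.real (Up ε \ Metric.ball c ε)))) (𝓝[>] 0)
      (𝓝 (Real.exp (-(lam * v)))) := by
    have h1 := (Real.continuous_exp.tendsto _).comp ((hball.const_mul lam).neg)
    have h2 := (Real.continuous_exp.tendsto _).comp ((hU.const_mul lam).neg)
    simpa using h1.mul h2
  have hi : Tendsto (fun ε => Real.exp (-(lam * volume.real (Lo ε \ Metric.ball c ε)))) (𝓝[>] 0)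
      (𝓝 (Real.exp (-(lam * v)))) :=
    (Real.continuous_exp.tendsto _).comp ((hL.const_mul lam).neg)
  refine tendsto_of_tendsto_of_tendsto_of_le_of_le' lo hi ?_ ?_
  · filter_upwards [self_mem_nhdsWithin] with ε hε
    rw [le_div_iff₀ (hpos ε hε), mul_comm, ← hΦ.prob_single_empty hlam measurableSet_ball
      Metric.isBounded_ball ((mU ε).diff measurableSet_ball) ((bU ε).subset Set.sdiff_subset)
      Set.disjoint_sdiff_right]
    -- Monotonicity holds for arbitrary sets, so `G ε` need not be measurable.
    refine ENNReal.toReal_mono (measure_ne_top _ _) (measure_mono_ae ?_)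
    filter_upwards [lower ε hε] with ω hω h using hω h.1 h.2
  · filter_upwards [self_mem_nhdsWithin] with ε hε
    rw [div_le_iff₀ (hpos ε hε), mul_comm]
    refine le_trans ?_ (hΦ.prob_nonempty_empty_le hlam measurableSet_ball
      Metric.isBounded_ball ((mL ε).diff measurableSet_ball) ((bL ε).subset Set.sdiff_subset)
      Set.disjoint_sdiff_right)
    refine ENNReal.toReal_mono (measure_ne_top _ _) (measure_mono_ae ?_)
    filter_upwards [upper ε hε] with ω hω h using hω h

/-- A lone point `p` of `S` in a small ball around `xs` is the nearest point, and `x` is in its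
cell, if no other point is near the two discs that matter. -/
theorem mem_cell_of_single {S : Set Plane} {xs x : Plane} {ε : ℝ}
    (hfin : ∀ B : Set Plane, Bornology.IsBounded B → (S ∩ B).Finite)
    (h1 : (S ∩ Metric.ball xs ε).ncard = 1)
    (h0 : (S ∩ ((Metric.ball 0 (‖xs‖ + ε) ∪ Metric.ball x (dist x xs + ε)) \
      Metric.ball xs ε)).ncard = 0) :
    x ∈ voronoiCell S (nearestPoint S) ∧ nearestPoint S ∈ Metric.ball xs ε := by
  obtain ⟨p, hp⟩ := Set.ncard_eq_one.1 h1
  have hpm : p ∈ S ∩ Metric.ball xs ε := by rw [hp]; rfl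
  have hpd : dist p xs < ε := hpm.2
  -- An infinite set also has `ncard` zero, so emptiness requires local finiteness.
  rw [Set.ncard_eq_zero (hfin _ ((Metric.isBounded_ball.union Metric.isBounded_ball).subset
    Set.sdiff_subset))] at h0
  have hout : ∀ z ∈ S, z ≠ p → ‖xs‖ + ε ≤ ‖z‖ ∧ dist x xs + ε ≤ dist x z := by
    intro z hz hzp
    have hzD : z ∉ Metric.ball xs ε := fun h => hzp (by
      have : z ∈ S ∩ Metric.ball xs ε := ⟨hz, h⟩
      rwa [hp] at this)
    by_contra hcon
    refine (Set.eq_empty_iff_forall_notMem.1 h0 z) ⟨hz, ?_, hzD⟩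
    rw [not_and_or, not_le, not_le] at hcon
    rcases hcon with h | h
    · exact Or.inl (by simpa using h)
    · exact Or.inr (by rw [Metric.mem_ball, dist_comm]; exact h)
  have hnear : nearestPoint S = p := by
    refine nearestPoint_eq hpm.1 fun z hz hzp => ?_
    have := (hout z hz hzp).1
    have h2 : ‖p‖ ≤ ‖xs‖ + dist p xs := by
      rw [dist_eq_norm]
      simpa using norm_add_le xs (p - xs)
    linarith
  rw [hnear]
  refine ⟨fun z hz => ?_, hpm.2⟩
  have := (hout z hz.1 hz.2).2
  have h2 := dist_triangle x xs p
  rw [dist_comm xs p] at h2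
  linarith

theorem ball_empty_of_near {S : Set Plane} {xs : Plane} {ε : ℝ}
    (hmin : ∀ z ∈ S, ‖nearestPoint S‖ ≤ ‖z‖) (hD : nearestPoint S ∈ Metric.ball xs ε)
    {z : Plane} (hz : z ∈ S) : ‖xs‖ - ε ≤ ‖z‖ := by
  have h1 := hmin z hz
  have h2 : ‖xs‖ ≤ ‖nearestPoint S‖ + dist (nearestPoint S) xs := by
    rw [dist_comm, dist_eq_norm]
    simpa using norm_add_le (nearestPoint S) (xs - nearestPoint S)
  have h3 : dist (nearestPoint S) xs < ε := hD
  linarith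

theorem ball_empty_of_mem_cell {S : Set Plane} {xs x : Plane} {ε : ℝ}
    (hx : x ∈ voronoiCell S (nearestPoint S)) (hD : nearestPoint S ∈ Metric.ball xs ε)
    {z : Plane} (hz : z ∈ S) (hzD : z ∉ Metric.ball xs ε) : dist x xs - ε ≤ dist z x := by
  have h1 := hx z ⟨hz, fun h => hzD (by rw [Set.mem_singleton_iff.1 h]; exact hD)⟩
  have h2 := dist_triangle x (nearestPoint S) xs
  have h3 : dist (nearestPoint S) xs < ε := hD
  rw [dist_comm z x]
  linarith

theorem tendsto_neg_nhdsGT_zero : Tendsto (fun ε : ℝ => -ε) (𝓝[>] 0) (𝓝 0) := by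
  simpa using (continuous_neg.tendsto (0 : ℝ)).mono_left nhdsWithin_le_nhds

theorem IsHomogeneousPPP.tendsto_cell_prob (hΦ : IsHomogeneousPPP P Φ lam) (hlam : 0 < lam)
    (xs x : Plane) :
    Tendsto (fun ε => P.real {ω | x ∈ voronoiCell (Φ ω) (nearestPoint (Φ ω)) ∧
        nearestPoint (Φ ω) ∈ Metric.ball xs ε} / (lam * volume.real (Metric.ball xs ε))) (𝓝[>] 0)
      (𝓝 (Real.exp (-(lam * volume.real
        (Metric.ball 0 ‖xs‖ ∪ Metric.ball x (dist x xs)))))) := by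
  refine hΦ.tendsto_prob_div hlam xs _
    (fun ε => Metric.ball 0 (‖xs‖ + ε) ∪ Metric.ball x (dist x xs + ε))
    (fun ε => Metric.ball 0 (‖xs‖ + -ε) ∪ Metric.ball x (dist x xs + -ε))
    (fun ε => measurableSet_ball.union measurableSet_ball)
    (fun ε => Metric.isBounded_ball.union Metric.isBounded_ball)
    (fun ε => measurableSet_ball.union measurableSet_ball)
    (fun ε => Metric.isBounded_ball.union Metric.isBounded_ball)
    (tendsto_volume_real_ball_union_diff _ _ _ _ _ (tendsto_id.mono_left nhdsWithin_le_nhds))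
    (tendsto_volume_real_ball_union_diff _ _ _ _ _ tendsto_neg_nhdsGT_zero) ?_ ?_
  · intro ε _
    filter_upwards [hΦ.locallyFinite] with ω hfin h1 h0
    exact mem_cell_of_single hfin h1 h0
  · intro ε _
    filter_upwards [hΦ.locallyFinite, hΦ.ae_nonempty hlam] with ω hfin hne hω
    have hs := nearestPoint_spec hne hfin
    refine ⟨?_, ?_⟩
    · rw [ne_eq, Set.ncard_eq_zero (hfin _ Metric.isBounded_ball)]
      exact Set.nonempty_iff_ne_empty.1 ⟨_, hs.1, hω.2⟩
    · rw [Set.ncard_eq_zero (hfin _ ((Metric.isBounded_ball.union Metric.isBounded_ball).subset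
        Set.sdiff_subset))]
      refine Set.eq_empty_iff_forall_notMem.2 ?_
      rintro z ⟨hz, hz1 | hz1, hzD⟩
      · have := ball_empty_of_near hs.2 hω.2 hz
        rw [mem_ball_zero_iff] at hz1
        linarith
      · have := ball_empty_of_mem_cell hω.1 hω.2 hz hzD
        rw [Metric.mem_ball] at hz1
        linarith

theorem IsHomogeneousPPP.tendsto_nearestPoint_prob (hΦ : IsHomogeneousPPP P Φ lam)
    (hlam : 0 < lam) (xs : Plane) :
    Tendsto (fun ε => P.real {ω | nearestPoint (Φ ω) ∈ Metric.ball xs ε} /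
        (lam * volume.real (Metric.ball xs ε))) (𝓝[>] 0)
      (𝓝 (Real.exp (-(lam * volume.real (Metric.ball (0 : Plane) ‖xs‖))))) := by
  -- A single disc is treated as its union with itself, i.e. the case `x = 0`, where `dist 0 xs =
  -- ‖xs‖`.
  have hU := tendsto_volume_real_ball_union_diff 0 0 xs ‖xs‖ ‖xs‖
    (tendsto_id.mono_left nhdsWithin_le_nhds)
  have hL := tendsto_volume_real_ball_union_diff 0 0 xs ‖xs‖ ‖xs‖ tendsto_neg_nhdsGT_zero
  simp only [Set.union_self, id] at hU hL
  refine hΦ.tendsto_prob_div hlam xs _ (fun ε => Metric.ball 0 (‖xs‖ + ε))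
    (fun ε => Metric.ball 0 (‖xs‖ + -ε)) (fun ε => measurableSet_ball)
    (fun ε => Metric.isBounded_ball) (fun ε => measurableSet_ball)
    (fun ε => Metric.isBounded_ball) hU hL ?_ ?_
  · intro ε _
    filter_upwards [hΦ.locallyFinite] with ω hfin h1 h0
    refine (mem_cell_of_single (x := 0) hfin h1 ?_).2
    simpa using h0
  · intro ε _
    filter_upwards [hΦ.locallyFinite, hΦ.ae_nonempty hlam] with ω hfin hne hω
    have hs := nearestPoint_spec hne hfin
    refine ⟨?_, ?_⟩
    · rw [ne_eq, Set.ncard_eq_zero (hfin _ Metric.isBounded_ball)]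
      exact Set.nonempty_iff_ne_empty.1 ⟨_, hs.1, hω⟩
    · rw [Set.ncard_eq_zero (hfin _ (Metric.isBounded_ball.subset Set.sdiff_subset))]
      refine Set.eq_empty_iff_forall_notMem.2 ?_
      rintro z ⟨hz, hz1, -⟩
      have := ball_empty_of_near hs.2 hω hz
      rw [mem_ball_zero_iff] at hz1
      linarith

theorem IsHomogeneousPPP.tendsto_cellProbNear (hΦ : IsHomogeneousPPP P Φ lam) (hlam : 0 < lam)
    (xs x : Plane) :
    Tendsto (cellProbNear P Φ xs x) (𝓝[>] 0) (𝓝 (Real.exp (-(lam * volume.real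
      (Metric.ball x (dist x xs) \ Metric.ball 0 ‖xs‖))))) := by
  have h := (hΦ.tendsto_cell_prob hlam xs x).div (hΦ.tendsto_nearestPoint_prob hlam xs)
    (Real.exp_pos _).ne'
  rw [← Real.exp_sub] at h
  -- The conditioning cancels the void probability of `B(0, ‖xs‖)`, leaving only the area outside
  -- it.
  have hv : volume.real (Metric.ball 0 ‖xs‖ ∪ Metric.ball x (dist x xs)) =
      volume.real (Metric.ball (0 : Plane) ‖xs‖) +
        volume.real (Metric.ball x (dist x xs) \ Metric.ball 0 ‖xs‖) := by
    rw [← Set.union_sdiff_self, measureReal_union Set.disjoint_sdiff_right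
      (measurableSet_ball.diff measurableSet_ball) (Metric.isBounded_ball.measure_lt_top.ne)
      ((Metric.isBounded_ball.subset Set.sdiff_subset).measure_lt_top.ne)]
  rw [hv] at h
  refine (h.congr' ?_).trans (le_of_eq ?_)
  · filter_upwards [self_mem_nhdsWithin] with ε hε
    have hpos : lam * volume.real (Metric.ball xs ε) ≠ 0 := by
      rw [volume_real_ball, max_eq_left (le_of_lt hε)]
      have := Real.pi_pos
      have : (0 : ℝ) < ε := hε
      positivity
    simp only [Pi.div_apply]
    rw [div_div_div_cancel_right₀ hpos]
    rfl
  · congr 2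
    ring

theorem IsHomogeneousPPP.pca_eq (hΦ : IsHomogeneousPPP P Φ lam) (hlam : 0 < lam)
    (xs x : Plane) :
    pca P Φ xs x = Real.exp (-(lam * volume.real
      (Metric.ball x (dist x xs) \ Metric.ball 0 ‖xs‖))) :=
  (hΦ.tendsto_cellProbNear hlam xs x).limUnder_eq

end Poisson

end CellularNetwork
-- Geometry of small discs whose boundary passes through `xs`
namespace CellularNetwork

theorem norm_polar {r : ℝ} (hr : 0 ≤ r) (θ : ℝ) : ‖polar r θ‖ = r := by
  rw [EuclideanSpace.norm_eq, Real.sqrt_eq_iff_mul_self_eq (by positivity) hr]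
  simp only [polar, Fin.sum_univ_two, Real.norm_eq_abs, sq_abs]
  simp
  linear_combination r ^ 2 * Real.sin_sq_add_cos_sq θ

theorem polar_add_pi (r θ : ℝ) : polar r (θ + Real.pi) = -polar r θ := by
  ext i
  fin_cases i <;> simp [polar]

theorem continuous_polar (r : ℝ) : Continuous (polar r) := by
  refine (PiLp.continuous_toLp 2 _).comp (continuous_pi fun i => ?_)
  fin_cases i
  · exact continuous_const.mul Real.continuous_cos
  · exact continuous_const.mul Real.continuous_sin

/-- These areas are the measures of the sections of one measurable subset of `ℝ × Plane`. -/
theorem measurable_volume_real_ball_diff (c : Plane) (r ρ : ℝ) :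
    Measurable fun θ => volume.real (Metric.ball (polar r θ + c) r \ Metric.ball 0 ρ) := by
  have hpol := continuous_polar r
  have hs : MeasurableSet {q : ℝ × Plane | dist q.2 (polar r q.1 + c) < r ∧ ¬ dist q.2 0 < ρ} := by
    have h1 : IsOpen {q : ℝ × Plane | dist q.2 (polar r q.1 + c) < r} :=
      isOpen_lt (by fun_prop) (by fun_prop)
    have h2 : IsOpen {q : ℝ × Plane | dist q.2 0 < ρ} := isOpen_lt (by fun_prop) (by fun_prop)
    exact h1.measurableSet.inter h2.measurableSet.compl
  exact (measurable_measure_prodMk_left (ν := (volume : Measure Plane)) hs).ennreal_toReal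

/-- Point reflection through `c`. -/
theorem volume_real_ball_diff_reflect (v c : Plane) (r ρ : ℝ) :
    volume.real (Metric.ball (-v + c) r \ Metric.ball 0 ρ) =
      volume.real (Metric.ball (v + c) r \ Metric.ball (c + c) ρ) := by
  have h := (Measure.measurePreserving_sub_left (volume : Measure Plane) (c + c)).measureReal_preimage
    (s := Metric.ball (-v + c) r \ Metric.ball 0 ρ)
    (measurableSet_ball.diff measurableSet_ball).nullMeasurableSet
  rw [← h]
  congr 1
  ext y
  have e : ‖c + c - y - (-v + c)‖ = ‖y - (v + c)‖ := by
    rw [← norm_neg]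
    congr 1
    abel
  simp only [Set.mem_preimage, Set.mem_sdiff, Metric.mem_ball, dist_eq_norm, e, sub_zero,
    norm_sub_rev (c + c) y]

/-- Two disjoint sets remove from `B` in total `|B|` minus the part of `B` they leave. -/
theorem measureReal_diff_add_diff {α : Type*} [MeasurableSpace α] {μ : Measure α} {B S T : Set α}
    (hT : MeasurableSet T) (hd : Disjoint S T) (hB : μ B ≠ ⊤) :
    μ.real (B \ S) + μ.real (B \ T) = μ.real B + μ.real (B \ (S ∪ T)) := by
  have h1 := measureReal_inter_add_sdiff (μ := μ) (s := B) (t := T) hT hB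
  have hBS : μ (B \ S) ≠ ⊤ := measure_ne_top_of_subset Set.sdiff_subset hB
  have h2 := measureReal_inter_add_sdiff (μ := μ) (s := B \ S) (t := T) hT hBS
  have e1 : (B \ S) ∩ T = B ∩ T := by
    ext y
    have : y ∈ S → y ∉ T := fun h => Set.disjoint_left.1 hd h
    simp only [Set.mem_inter_iff, Set.mem_sdiff]
    tauto
  rw [e1, Set.sdiff_sdiff] at h2
  linarith

/-- The two linear forms are the coordinates along and across `c`, scaled by `‖c‖`; the map they
define has determinant `‖c‖ ^ 2`. -/
theorem volume_real_preimage_rotation_Icc {c : Plane} (hc : c ≠ 0) {a b : ℝ} (ha : 0 ≤ a)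
    (hb : 0 ≤ b) :
    volume.real {w : Plane | |w 0 * c 0 + w 1 * c 1| ≤ a ∧ |w 1 * c 0 - w 0 * c 1| ≤ b} =
      4 * a * b / ‖c‖ ^ 2 := by
  set M : Matrix (Fin 2) (Fin 2) ℝ := !![c 0, c 1; -c 1, c 0] with hM
  have hnorm : ‖c‖ ^ 2 = c 0 ^ 2 + c 1 ^ 2 := by
    rw [EuclideanSpace.norm_sq_eq]
    simp
  have hpos : 0 < ‖c‖ ^ 2 := by positivity
  have hdet : LinearMap.det (Matrix.toLin' M) = ‖c‖ ^ 2 := by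
    rw [LinearMap.det_toLin', hM, Matrix.det_fin_two_of, hnorm]
    ring
  have hset : {w : Plane | |w 0 * c 0 + w 1 * c 1| ≤ a ∧ |w 1 * c 0 - w 0 * c 1| ≤ b} =
      (@WithLp.ofLp 2 (Fin 2 → ℝ)) ⁻¹' (Matrix.toLin' M ⁻¹' Set.Icc (![-a, -b]) (![a, b])) := by
    ext w
    simp only [Set.mem_ofPred_eq, Set.mem_preimage, Set.mem_Icc, Pi.le_def, Fin.forall_fin_two,
      Matrix.toLin'_apply, hM, abs_le]
    simp only [Matrix.mulVec, dotProduct, Fin.sum_univ_two, Matrix.of_apply, Matrix.cons_val_zero,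
      Matrix.cons_val_one, Matrix.cons_val']
    have e1 : w 0 * c 0 + w 1 * c 1 = c 0 * w 0 + c 1 * w 1 := by ring
    have e2 : w 1 * c 0 - w 0 * c 1 = -c 1 * w 0 + c 0 * w 1 := by ring
    rw [← e1, ← e2]
    constructor
    · rintro ⟨⟨h1, h2⟩, h3, h4⟩
      refine ⟨⟨h1, ?_⟩, h2, ?_⟩ <;> linarith
    · rintro ⟨⟨h1, h2⟩, h3, h4⟩
      refine ⟨⟨h1, h3⟩, ?_, ?_⟩ <;> linarith
  have hle : ![-a, -b] ≤ ![a, b] := by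
    rw [Pi.le_def, Fin.forall_fin_two]
    simp
    constructor <;> linarith
  rw [hset, measureReal_def, (PiLp.volume_preserving_ofLp (Fin 2)).measure_preimage
    ((Matrix.toLin' M).continuous_of_finiteDimensional.measurable measurableSet_Icc).nullMeasurableSet,
    Measure.addHaar_preimage_linearMap _ (by rw [hdet]; exact hpos.ne'), ENNReal.toReal_mul,
    Real.volume_Icc_pi_toReal hle, hdet, ENNReal.toReal_ofReal (abs_nonneg _), abs_of_pos
    (by positivity), Fin.prod_univ_two]
  simp
  field_simp
  ring

theorem inner_eq_coords (w c : Plane) : inner ℝ w c = w 0 * c 0 + w 1 * c 1 := by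
  rw [PiLp.inner_apply, Fin.sum_univ_two]
  simp [mul_comm]

/-- The part of a disc of radius `r` through `c` outside the two discs of radius `‖c‖` that touch
each other at `c` has area `O(r ^ 3)`. -/
theorem volume_real_ball_diff_union_le {v c : Plane} (hc : c ≠ 0) {r : ℝ} (hr : 0 ≤ r)
    (hv : ‖v‖ = r) :
    volume.real (Metric.ball (v + c) r \ (Metric.ball 0 ‖c‖ ∪ Metric.ball (c + c) ‖c‖)) ≤
      16 / ‖c‖ * r ^ 3 := by
  have hcpos : 0 < ‖c‖ := norm_pos_iff.2 hc
  -- With `w = y - c`, lying outside both discs means `2 |⟨w, c⟩| ≤ ‖w‖ ^ 2`, and `‖w‖ ≤ 2 r`; this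
  -- yields both bounds. The area is `4 (2 r²) (2 r ‖c‖) / ‖c‖² = 16 r³ / ‖c‖`.
  set S := {w : Plane | |w 0 * c 0 + w 1 * c 1| ≤ 2 * r ^ 2 ∧
    |w 1 * c 0 - w 0 * c 1| ≤ 2 * r * ‖c‖} with hS
  have hvol := volume_real_preimage_rotation_Icc hc (a := 2 * r ^ 2) (b := 2 * r * ‖c‖)
    (by positivity) (by positivity)
  rw [← hS] at hvol
  have hSc : IsClosed S := by
    have h1 : IsClosed {w : Plane | |w 0 * c 0 + w 1 * c 1| ≤ 2 * r ^ 2} :=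
      isClosed_le (by fun_prop) (by fun_prop)
    have h2 : IsClosed {w : Plane | |w 1 * c 0 - w 0 * c 1| ≤ 2 * r * ‖c‖} :=
      isClosed_le (by fun_prop) (by fun_prop)
    exact h1.inter h2
  have hpre := (measurePreserving_sub_right (volume : Measure Plane) c).measureReal_preimage
    hSc.measurableSet.nullMeasurableSet
  have hSpos : volume.real S ≤ 16 / ‖c‖ * r ^ 3 := by
    rw [hvol]
    apply le_of_eq
    field_simp
    ring
  have hbd : Bornology.IsBounded ((fun y : Plane => y - c) ⁻¹' S) := by
    refine (Metric.isBounded_closedBall (x := c) (r := 2 * r ^ 2 / ‖c‖ + 2 * r)).subset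
      fun y hy => ?_
    obtain ⟨h1, h2⟩ := hy
    rw [Metric.mem_closedBall, dist_eq_norm]
    set w := y - c
    have e : (‖w‖ * ‖c‖) ^ 2 = (w 0 * c 0 + w 1 * c 1) ^ 2 + (w 1 * c 0 - w 0 * c 1) ^ 2 := by
      rw [mul_pow, EuclideanSpace.norm_sq_eq, EuclideanSpace.norm_sq_eq]
      simp only [Fin.sum_univ_two, Real.norm_eq_abs, sq_abs]
      ring
    have h3 : ‖w‖ * ‖c‖ ≤ 2 * r ^ 2 + 2 * r * ‖c‖ := by
      refine abs_le_of_sq_le_sq' ?_ (by positivity) |>.2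
      rw [e, ← sq_abs (w 0 * c 0 + w 1 * c 1), ← sq_abs (w 1 * c 0 - w 0 * c 1)]
      have h1' := pow_le_pow_left₀ (abs_nonneg _) h1 2
      have h2' := pow_le_pow_left₀ (abs_nonneg _) h2 2
      have : 0 ≤ 2 * r ^ 2 * (2 * r * ‖c‖) := by positivity
      nlinarith
    have h4 : 2 * r ^ 2 / ‖c‖ + 2 * r = (2 * r ^ 2 + 2 * r * ‖c‖) / ‖c‖ := by
      field_simp
    rw [h4, le_div_iff₀ hcpos]
    exact h3
  refine le_trans ?_ (hpre.le.trans hSpos)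
  refine measureReal_mono ?_ hbd.measure_lt_top.ne
  rintro y ⟨hy, hy2⟩
  rw [Set.mem_union, not_or] at hy2
  obtain ⟨h0, h1⟩ := hy2
  rw [Metric.mem_ball, dist_eq_norm, not_lt] at h0 h1
  rw [Metric.mem_ball, dist_eq_norm] at hy
  set w := y - c with hw
  have hw2 : ‖w‖ ≤ 2 * r := by
    have : w = (y - (v + c)) + v := by rw [hw]; abel
    rw [this]
    refine (norm_add_le _ _).trans ?_
    linarith
  have a0 : ‖c‖ ^ 2 ≤ ‖w + c‖ ^ 2 := by
    refine pow_le_pow_left₀ (norm_nonneg _) (h0.trans_eq ?_) 2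
    congr 1
    rw [hw]
    abel
  have a1 : ‖c‖ ^ 2 ≤ ‖w - c‖ ^ 2 := by
    refine pow_le_pow_left₀ (norm_nonneg _) (h1.trans_eq ?_) 2
    congr 1
    rw [hw]
    abel
  rw [norm_add_sq_real, inner_eq_coords] at a0
  rw [norm_sub_sq_real, inner_eq_coords] at a1
  have hwsq : ‖w‖ ^ 2 ≤ (2 * r) ^ 2 := pow_le_pow_left₀ (norm_nonneg _) hw2 2
  refine ⟨abs_le.2 ⟨?_, ?_⟩, ?_⟩
  · change _ ≤ w 0 * c 0 + w 1 * c 1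
    linarith
  · change w 0 * c 0 + w 1 * c 1 ≤ _
    linarith
  · change |w 1 * c 0 - w 0 * c 1| ≤ _
    refine (Real.abs_le_sqrt ?_).trans_eq (Real.sqrt_sq (by positivity))
    have e : (‖w‖ * ‖c‖) ^ 2 = (w 0 * c 0 + w 1 * c 1) ^ 2 + (w 1 * c 0 - w 0 * c 1) ^ 2 := by
      rw [mul_pow, EuclideanSpace.norm_sq_eq, EuclideanSpace.norm_sq_eq]
      simp only [Fin.sum_univ_two, Real.norm_eq_abs, sq_abs]
      ring
    have h5 : (‖w‖ * ‖c‖) ^ 2 ≤ (2 * r * ‖c‖) ^ 2 := by gcongr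
    nlinarith [sq_nonneg (w 0 * c 0 + w 1 * c 1)]

theorem abs_volume_real_ball_diff_add_sub_le {c : Plane} (hc : c ≠ 0) {r : ℝ} (hr : 0 ≤ r)
    (θ : ℝ) :
    |volume.real (Metric.ball (polar r θ + c) r \ Metric.ball 0 ‖c‖) +
        volume.real (Metric.ball (polar r (θ + Real.pi) + c) r \ Metric.ball 0 ‖c‖) -
        Real.pi * r ^ 2| ≤ 16 / ‖c‖ * r ^ 3 := by
  have hd : Disjoint (Metric.ball (0 : Plane) ‖c‖) (Metric.ball (c + c) ‖c‖) := by
    refine Metric.ball_disjoint_ball (le_of_eq ?_)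
    rw [dist_zero_left, ← two_smul ℝ c, norm_smul]
    simp [two_mul]
  rw [polar_add_pi, volume_real_ball_diff_reflect, measureReal_diff_add_diff
    measurableSet_ball hd Metric.isBounded_ball.measure_lt_top.ne, volume_real_ball,
    max_eq_left hr, add_sub_cancel_left, abs_of_nonneg measureReal_nonneg]
  exact volume_real_ball_diff_union_le hc hr (norm_polar hr θ)

theorem abs_one_sub_exp_neg_sub_le {t : ℝ} (ht : 0 ≤ t) : |1 - Real.exp (-t) - t| ≤ t ^ 2 := by
  have h1 := Real.add_one_le_exp (-t)
  have h2 : Real.exp (-t) ≤ 1 - t + t ^ 2 := by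
    -- Follows from `exp t ≥ 1 + t` and `(1 + t) (1 - t + t²) = 1 + t³ ≥ 1`.
    rw [Real.exp_neg, inv_le_comm₀ (Real.exp_pos t) (by nlinarith [sq_nonneg (t - 1)])]
    refine le_trans ?_ (Real.add_one_le_exp t)
    rw [inv_le_iff_one_le_mul₀ (by nlinarith [sq_nonneg (t - 1)])]
    nlinarith [pow_nonneg ht 3]
  rw [abs_le]
  constructor <;> linarith

/-! ### Asymptotics of the equivalent density -/

section Density

variable {Ω : Type*} [MeasurableSpace Ω] {P : Measure Ω} [IsProbabilityMeasure P]
  {Φ : Ω → Set Plane} {lam : ℝ}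

theorem IsHomogeneousPPP.pca_polar_add (hΦ : IsHomogeneousPPP P Φ lam) (hlam : 0 < lam)
    (xs : Plane) {r : ℝ} (hr : 0 ≤ r) (θ : ℝ) :
    pca P Φ xs (polar r θ + xs) = Real.exp (-(lam * volume.real
      (Metric.ball (polar r θ + xs) r \ Metric.ball 0 ‖xs‖))) := by
  rw [hΦ.pca_eq hlam, dist_eq_norm, add_sub_cancel_right, norm_polar hr]

theorem IsHomogeneousPPP.intervalIntegrable_pca (hΦ : IsHomogeneousPPP P Φ lam) (hlam : 0 < lam)
    (xs : Plane) {r : ℝ} (hr : 0 ≤ r) (a b : ℝ) :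
    IntervalIntegrable (fun θ => pca P Φ xs (polar r θ + xs)) volume a b := by
  simp only [hΦ.pca_polar_add hlam xs hr]
  refine (intervalIntegrable_const (c := (1 : ℝ))).mono_fun ?_ (Eventually.of_forall fun θ => ?_)
  · exact (Real.measurable_exp.comp
      ((measurable_volume_real_ball_diff xs r ‖xs‖).const_mul lam).neg).aestronglyMeasurable
  · simp only [norm_one]
    rw [Real.norm_eq_abs, Real.abs_exp, Real.exp_le_one_iff, neg_nonpos]
    positivity

theorem IsHomogeneousPPP.ueDensity_zero (hΦ : IsHomogeneousPPP P Φ lam) (hlam : 0 < lam)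
    (lamU : ℝ) {r : ℝ} (hr : 0 ≤ r) :
    ueDensity P Φ lamU 0 0 r = lamU * (1 - Real.exp (-(lam * (Real.pi * r ^ 2)))) := by
  have h : ∀ θ, pca P Φ 0 (polar r θ + 0) = Real.exp (-(lam * (Real.pi * r ^ 2))) := by
    intro θ
    rw [hΦ.pca_polar_add hlam 0 hr, norm_zero, Metric.ball_zero, Set.sdiff_empty,
      volume_real_ball, max_eq_left hr]
  have hpi := Real.pi_pos
  simp only [ueDensity, h, intervalIntegral.integral_const, sub_zero, smul_eq_mul]
  field_simp

theorem IsHomogeneousPPP.isBigO_ueDensity_zero (hΦ : IsHomogeneousPPP P Φ lam) (hlam : 0 < lam)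
    (lamU : ℝ) :
    (fun r : ℝ => ueDensity P Φ lamU 0 0 r - lamU * lam * 1 * Real.pi * r ^ 2)
      =O[𝓝[≥] (0 : ℝ)] (fun r : ℝ => r ^ 3) := by
  refine IsBigO.of_bound (|lamU| * (lam * Real.pi) ^ 2) ?_
  filter_upwards [self_mem_nhdsWithin, nhdsWithin_le_nhds (Iio_mem_nhds one_pos)] with r hr hr1
  have hr0 : (0 : ℝ) ≤ r := hr
  have hr1' : r ≤ 1 := le_of_lt hr1
  have hpi := Real.pi_pos
  rw [hΦ.ueDensity_zero hlam lamU hr0, Real.norm_eq_abs, Real.norm_eq_abs,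
    abs_of_nonneg (pow_nonneg hr0 3)]
  have e : lamU * (1 - Real.exp (-(lam * (Real.pi * r ^ 2)))) - lamU * lam * 1 * Real.pi * r ^ 2 =
      lamU * (1 - Real.exp (-(lam * (Real.pi * r ^ 2))) - lam * (Real.pi * r ^ 2)) := by ring
  rw [e, abs_mul, mul_assoc]
  gcongr
  refine (abs_one_sub_exp_neg_sub_le (by positivity)).trans ?_
  -- The error in linearising the exponential is of order `r ^ 4`; restricting to `r ≤ 1` absorbs it
  -- into `r ^ 3`.
  have h4 : r ^ 4 ≤ r ^ 3 := pow_le_pow_of_le_one hr0 hr1' (by norm_num)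
  calc (lam * (Real.pi * r ^ 2)) ^ 2 = (lam * Real.pi) ^ 2 * r ^ 4 := by ring
    _ ≤ (lam * Real.pi) ^ 2 * r ^ 3 := by gcongr

/-- The contributions of two opposite directions to the complementary probability. -/
theorem IsHomogeneousPPP.abs_opposite_pca_le (hΦ : IsHomogeneousPPP P Φ lam) (hlam : 0 < lam)
    {xs : Plane} (hxs : xs ≠ 0) {r : ℝ} (hr : 0 ≤ r) (hr1 : r ≤ 1) (θ : ℝ) :
    |(1 - pca P Φ xs (polar r θ + xs)) + (1 - pca P Φ xs (polar r (θ + Real.pi) + xs)) -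
        lam * (Real.pi * r ^ 2)| ≤ (lam * (16 / ‖xs‖) + 2 * (lam * Real.pi) ^ 2) * r ^ 3 := by
  have hpi := Real.pi_pos
  have hV := abs_volume_real_ball_diff_add_sub_le hxs hr θ
  have hle : ∀ φ, (lam * volume.real (Metric.ball (polar r φ + xs) r \ Metric.ball 0 ‖xs‖)) ^ 2 ≤
      (lam * Real.pi) ^ 2 * r ^ 3 := by
    intro φ
    have h1 : volume.real (Metric.ball (polar r φ + xs) r \ Metric.ball 0 ‖xs‖) ≤
        Real.pi * r ^ 2 := by
      refine (measureReal_mono Set.sdiff_subset Metric.isBounded_ball.measure_lt_top.ne).trans ?_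
      rw [volume_real_ball, max_eq_left hr]
    have h4 : r ^ 4 ≤ r ^ 3 := pow_le_pow_of_le_one hr hr1 (by norm_num)
    calc _ ≤ (lam * (Real.pi * r ^ 2)) ^ 2 := by gcongr
      _ = (lam * Real.pi) ^ 2 * r ^ 4 := by ring
      _ ≤ (lam * Real.pi) ^ 2 * r ^ 3 := by gcongr
  rw [hΦ.pca_polar_add hlam xs hr, hΦ.pca_polar_add hlam xs hr]
  have hA := hle θ
  have hB := hle (θ + Real.pi)
  set A := volume.real (Metric.ball (polar r θ + xs) r \ Metric.ball 0 ‖xs‖)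
  set B := volume.real (Metric.ball (polar r (θ + Real.pi) + xs) r \ Metric.ball 0 ‖xs‖)
  have hA0 : 0 ≤ lam * A := mul_nonneg hlam.le measureReal_nonneg
  have hB0 : 0 ≤ lam * B := mul_nonneg hlam.le measureReal_nonneg
  have eA := (abs_le.1 (abs_one_sub_exp_neg_sub_le hA0))
  have eB := (abs_le.1 (abs_one_sub_exp_neg_sub_le hB0))
  have hV' : |lam * A + lam * B - lam * (Real.pi * r ^ 2)| ≤ lam * (16 / ‖xs‖ * r ^ 3) := by
    rw [← mul_add, ← mul_sub, abs_mul, abs_of_pos hlam]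
    gcongr
  have hV2 := abs_le.1 hV'
  rw [abs_le]
  constructor <;> linarith [eA.1, eA.2, eB.1, eB.2, hV2.1, hV2.2]

theorem IsHomogeneousPPP.isBigO_ueDensity_of_ne (hΦ : IsHomogeneousPPP P Φ lam) (hlam : 0 < lam)
    (lamU : ℝ) {xs : Plane} (hxs : xs ≠ 0) :
    (fun r : ℝ => ueDensity P Φ lamU xs xs r - lamU * lam * (1 / 2) * Real.pi * r ^ 2)
      =O[𝓝[≥] (0 : ℝ)] (fun r : ℝ => r ^ 3) := by
  set C := lam * (16 / ‖xs‖) + 2 * (lam * Real.pi) ^ 2 with hC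
  -- The factor `1 / 2` is the normalisation `1 / (2 π)` times the length `π` of the half-turn over
  -- which opposite directions are paired.
  refine IsBigO.of_bound (|lamU| * (1 / 2 * C)) ?_
  filter_upwards [self_mem_nhdsWithin, nhdsWithin_le_nhds (Iio_mem_nhds one_pos)] with r hr hr1
  have hr0 : (0 : ℝ) ≤ r := hr
  have hr1' : r ≤ 1 := le_of_lt hr1
  have hpi := Real.pi_pos
  set g : ℝ → ℝ := fun θ => pca P Φ xs (polar r θ + xs) with hg
  have hint : ∀ a b, IntervalIntegrable g volume a b :=
    hΦ.intervalIntegrable_pca hlam xs hr0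
  have hint' : IntervalIntegrable (fun θ => g (θ + Real.pi)) volume 0 Real.pi := by
    simpa using (hint (0 + Real.pi) (Real.pi + Real.pi)).comp_add_right Real.pi
  have hsplit : ∫ θ in (0 : ℝ)..(2 * Real.pi), g θ =
      (∫ θ in (0 : ℝ)..Real.pi, g θ) + ∫ θ in (0 : ℝ)..Real.pi, g (θ + Real.pi) := by
    rw [intervalIntegral.integral_comp_add_right, zero_add, ← two_mul,
      intervalIntegral.integral_add_adjacent_intervals (hint _ _) (hint _ _)]
  have hrest : ∫ θ in (0 : ℝ)..Real.pi, ((1 - g θ) + (1 - g (θ + Real.pi)) -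
      lam * (Real.pi * r ^ 2)) =
      2 * Real.pi - (∫ θ in (0 : ℝ)..(2 * Real.pi), g θ) - Real.pi * (lam * (Real.pi * r ^ 2)) := by
    have hc : ∀ k : ℝ, IntervalIntegrable (fun _ : ℝ => k) volume 0 Real.pi := fun k =>
      intervalIntegrable_const
    rw [intervalIntegral.integral_sub (((hc 1).sub (hint _ _)).add ((hc 1).sub hint')) (hc _),
      intervalIntegral.integral_add ((hc 1).sub (hint _ _)) ((hc 1).sub hint'),
      intervalIntegral.integral_sub (hc 1) (hint _ _), intervalIntegral.integral_sub (hc 1) hint',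
      hsplit]
    simp only [intervalIntegral.integral_const, sub_zero, smul_eq_mul, mul_one]
    ring
  have hbound := intervalIntegral.norm_integral_le_of_norm_le_const (a := 0) (b := Real.pi)
    (C := C * r ^ 3) (f := fun θ => (1 - g θ) + (1 - g (θ + Real.pi)) - lam * (Real.pi * r ^ 2))
    (fun θ _ => hΦ.abs_opposite_pca_le hlam hxs hr0 hr1' θ)
  rw [hrest, sub_zero, abs_of_pos hpi, Real.norm_eq_abs] at hbound
  rw [Real.norm_eq_abs, Real.norm_eq_abs, abs_of_nonneg (pow_nonneg hr0 3)]
  have e : ueDensity P Φ lamU xs xs r - lamU * lam * (1 / 2) * Real.pi * r ^ 2 =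
      lamU * (1 / (2 * Real.pi) * (2 * Real.pi - (∫ θ in (0 : ℝ)..(2 * Real.pi), g θ) -
        Real.pi * (lam * (Real.pi * r ^ 2)))) := by
    rw [ueDensity]
    field_simp
    ring
  rw [e, abs_mul, mul_assoc, abs_mul, abs_of_pos (by positivity : 0 < 1 / (2 * Real.pi))]
  refine mul_le_mul_of_nonneg_left ?_ (abs_nonneg _)
  calc _ ≤ 1 / (2 * Real.pi) * (C * r ^ 3 * Real.pi) := by gcongr
    _ = 1 / 2 * C * r ^ 3 := by field_simp

end Density

end CellularNetwork

theorem proposition4 {Ω : Type*} [MeasurableSpace Ω] (P : Measure Ω) [IsProbabilityMeasure P]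
    (Φ : Ω → Set CellularNetwork.Plane) (lamA lamU : ℝ) (hA : 0 < lamA) (hU : 0 < lamU)
    (hΦ : CellularNetwork.IsHomogeneousPPP P Φ lamA) (xs : CellularNetwork.Plane) :
    -- the conditional probabilities and the integrals in the equivalent density are well defined
    (∀ x : CellularNetwork.Plane,
      Tendsto (CellularNetwork.cellProbNear P Φ xs x) (𝓝[>] (0 : ℝ))
        (𝓝 (CellularNetwork.pca P Φ xs x))) ∧
    (∀ r : ℝ, 0 ≤ r → IntervalIntegrable
      (fun θ => CellularNetwork.pca P Φ xs (CellularNetwork.polar r θ + xs))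
      volume 0 (2 * Real.pi)) ∧
    -- the asymptotics of the equivalent density at the serving AP
    (xs = 0 →
      (fun r : ℝ => CellularNetwork.ueDensity P Φ lamU xs xs r - lamU * lamA * 1 * Real.pi * r ^ 2)
        =O[𝓝[≥] (0 : ℝ)] (fun r : ℝ => r ^ 3)) ∧
    (xs ≠ 0 →
      (fun r : ℝ =>
          CellularNetwork.ueDensity P Φ lamU xs xs r - lamU * lamA * (1 / 2) * Real.pi * r ^ 2)
        =O[𝓝[≥] (0 : ℝ)] (fun r : ℝ => r ^ 3)) := by
  refine ⟨fun x => ?_, fun r hr => hΦ.intervalIntegrable_pca hA xs hr _ _, ?_, ?_⟩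
  · rw [hΦ.pca_eq hA]
    exact hΦ.tendsto_cellProbNear hA xs x
  · rintro rfl
    exact hΦ.isBigO_ueDensity_zero hA lamU
  · exact fun hxs => hΦ.isBigO_ueDensity_of_ne hA lamU hxs
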